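/- Let $(\Omega,\Sigma,\nu)$ be a complete probability space and let $X$ and $Y$ be real Banach spaces. Write $\mathrm{Ba}(X,w)$ for the Baire $\sigma$-algebra of $X$ with its weak topology $w$, i.e. the smallest $\sigma$-algebra on $X$ making every weakly continuous function $X\to\mathbb{R}$ measurable. Suppose that * $X$ is weakly measure-compact: every probability measure $P$ on $\mathrm{Ba}(X,w)$ is $\tau$-smooth, i.e. $\lim_\alpha\int_X h_\alpha\,dP=0$ for every net $(h_\alpha)$ of bounded weakly continuous functions $h_\alpha:X\to\mathbb{R}$ which decreases pointwise to $0$; and * $X$ has property $(\mathcal{D})$: $\mathrm{Ba}(X,w)=\sigma(\Gamma)$ for every total set $\Gamma\subseteq X^*$ (i.e. such that for each $x\in X\setminus\{0\}$ there is $x^*\in\Gamma$ with $x^*(x)\neq 0$), where $\sigma(\Gamma)$ is the smallest $\sigma$-algebra on $X$ making every $x^*\in\Gamma$ measurable. Let $T:X\to Y$ be an injective continuous linear map and let $f:\Omega\to X$ be a function. If $T\circ f:\Omega\to Y$ is strongly measurable (i.e. the $\nu$-almost everywhere limit, in norm, of a sequence of $\Sigma$-measurable functions with finitely many values), then $f$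 is strongly measurable. -/

import Mathlib

open MeasureTheory Filter Topology

/-- The Baire `σ`-algebra of a topological space `Z`: the smallest `σ`-algebra on `Z` for which
every continuous function `Z → ℝ` is measurable. -/
abbrev baireSigma (Z : Type*) [TopologicalSpace Z] : MeasurableSpace Z :=
  ⨆ g : C(Z, ℝ), MeasurableSpace.comap g (borel ℝ)

section Banach

universe u

variable (X : Type u) [NormedAddCommGroup X] [NormedSpace ℝ X]

/-- `Ba(X, w)`: the Baire `σ`-algebra of `X` with its weak topology, as a `σ`-algebra on `X`
(the map `toWeakSpace ℝ X` is the identity, from `X` to `X` with the weak topology). -/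
noncomputable abbrev weakBaire : MeasurableSpace X :=
  MeasurableSpace.comap (toWeakSpace ℝ X) (baireSigma (WeakSpace ℝ X))

variable {X} in
/-- `σ(Γ)`: the smallest `σ`-algebra on `X` for which each functional in `Γ` is measurable. -/
abbrev functionalSigma (Γ : Set (StrongDual ℝ X)) : MeasurableSpace X :=
  ⨆ φ ∈ Γ, MeasurableSpace.comap φ (borel ℝ)

variable {X} in
/-- A set of functionals is total if it separates the points of `X`. -/
def IsTotalSet (Γ : Set (StrongDual ℝ X)) : Prop :=
  ∀ x : X, x ≠ 0 → ∃ φ ∈ Γ, φ x ≠ 0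

/-- Property (D): `Ba(X, w) = σ(Γ)` for every total set `Γ` in the dual of `X`. -/
def HasPropertyD : Prop :=
  ∀ Γ : Set (StrongDual ℝ X), IsTotalSet Γ → weakBaire X = functionalSigma Γ

/-- A measure `P` on `Ba(X, w)` is `τ`-smooth if `∫ h_α dP → 0` for every net `h_α` of bounded
weakly continuous real functions that decreases pointwise to `0`.

Index sets in the universe of `X` suffice: the integrals along a decreasing net depend only on its
range, a directed set of functions on `X`. -/
def IsTauSmooth (P : @Measure X (weakBaire X)) : Prop :=
  ∀ (ι : Type u) [Preorder ι] [IsDirectedOrder ι] [Nonempty ι]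
    (h : ι → BoundedContinuousFunction (WeakSpace ℝ X) ℝ),
    (∀ i j, i ≤ j → ∀ x, h j x ≤ h i x) →
    (∀ x, Tendsto (fun i => h i x) atTop (𝓝 0)) →
    Tendsto (fun i => ∫ x, h i (toWeakSpace ℝ X x) ∂P) atTop (𝓝 0)

/-- `X` is weakly measure-compact if every probability measure on `Ba(X, w)` is `τ`-smooth. -/
def IsWeaklyMeasureCompact : Prop :=
  ∀ P : @Measure X (weakBaire X), @IsProbabilityMeasure X (weakBaire X) P → IsTauSmooth X P

end Banach

/-!
The image measure `P` of `ν` under `f` lives on `Ba(X, w)`: by property (D), applied to the total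
set of the functionals `y* ∘ T`, `f` is measurable into `Ba(X, w)` as soon as `T ∘ f` is strongly
measurable. For the same reason `f` stays measurable when the `σ`-algebra of `Ω` is replaced by the
one generated by `T ∘ f`, and that one is countably generated, because `T ∘ f` has separable range.

Let `S` be the support of `P` (`weakSupport`). A functional that vanishes `P`-almost everywhere
vanishes on `S`, and two facts finish the proof.

* `S` is norm separable (`isSeparable_of_countablyGenerated`). On the unit ball of the dual,
  consider the pseudometric of convergence in measure of `φ ∘ f`; it is separable since the
  `σ`-algebra is countably generated. If `φₙ → φ` in this sense, a subsequence of `φₙ ∘ f` converges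
  almost everywhere, each weak-* cluster point of it agrees with `φ` almost everywhere, hence on
  `S`; so evaluation at a point of `S` is continuous. A countable base then yields a countable set
  with the same annihilator as `S`.
* Every zero set of positive measure of a weakly continuous function meets `S`
  (`exists_mem_weakSupport_of_isTauSmooth`); this is where `τ`-smoothness is used.

Let `Z` be the closure of `S`, a Polish space. Countably many functionals `yₙ* ∘ T` form a weakly
continuous map `Φ : X → ℝ^ℕ` which is injective on `Z` together with the range of `f`. By the
Lusin–Souslin theorem `Φ` restricts to a measurable embedding of `Z`, so `Φ(Z)` is Borel. Its
complement has measure zero under the law of `Φ ∘ f`, for otherwise a closed subset of the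
complement would pull back to a zero set of positive measure that misses `S`. Hence `f` takes
values in `Z` almost everywhere, and inverting the embedding makes it strongly measurable.
-/

/-! ### Separating functionals -/

theorem exists_seq_dual_separating {Y : Type*} [NormedAddCommGroup Y] [NormedSpace ℝ Y]
    {W : Set Y} (hW : TopologicalSpace.IsSeparable W) :
    ∃ y : ℕ → StrongDual ℝ Y, ∀ w ∈ W, (∀ n, y n w = 0) → w = 0 := by
  obtain ⟨c, hc, hWc⟩ := hW
  rcases c.eq_empty_or_nonempty with rfl | hne
  · exact ⟨fun _ => 0, fun w hw => by simpa using hWc hw⟩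
  obtain ⟨d, rfl⟩ := hc.exists_eq_range hne
  choose y hy hyd using fun n => exists_dual_vector'' ℝ (d n)
  refine ⟨y, fun w hw h0 => ?_⟩
  by_contra hne
  have hpos : 0 < ‖w‖ := norm_pos_iff.2 hne
  obtain ⟨_, ⟨n, rfl⟩, hn⟩ := Metric.mem_closure_iff.1 (hWc hw) (‖w‖ / 2) (by positivity)
  rw [dist_eq_norm] at hn
  have h1 : ‖d n‖ ≤ ‖w - d n‖ := by
    have h2 : y n (w - d n) = -‖d n‖ := by
      rw [map_sub, h0 n, hyd n]; simp
    have h3 := (y n).le_of_opNorm_le (hy n) (w - d n)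
    rw [h2] at h3
    simpa using h3
  have h4 : ‖w‖ ≤ ‖w - d n‖ + ‖d n‖ := by simpa using norm_add_le (w - d n) (d n)
  linarith

/-! ### The support of a Baire measure -/

section Support

variable {X : Type*} [NormedAddCommGroup X] [NormedSpace ℝ X]

/-- The support of a measure `P` on `Ba(X, w)`: the common zero set of all nonnegative bounded
weakly continuous functions whose integral vanishes. -/
def weakSupport (P : @Measure X (weakBaire X)) : Set X :=
  {x | ∀ k : BoundedContinuousFunction (WeakSpace ℝ X) ℝ, (∀ z, 0 ≤ k z) →
    ∫ z, k (toWeakSpace ℝ X z) ∂P = 0 → k (toWeakSpace ℝ X x) = 0}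

theorem measurable_weakBaire_of_continuous (g : C(WeakSpace ℝ X, ℝ)) :
    Measurable[weakBaire X] (fun x : X => g (toWeakSpace ℝ X x)) := by
  have h1 : Measurable[baireSigma (WeakSpace ℝ X)] g := by
    rw [measurable_iff_comap_le, BorelSpace.measurable_eq (α := ℝ)]
    exact le_iSup (fun g : C(WeakSpace ℝ X, ℝ) => MeasurableSpace.comap g (borel ℝ)) g
  exact h1.comp (comap_measurable _)

theorem integrable_weakBaire {P : @Measure X (weakBaire X)} [@IsFiniteMeasure X (weakBaire X) P]
    (k : BoundedContinuousFunction (WeakSpace ℝ X) ℝ) :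
    Integrable (fun x => k (toWeakSpace ℝ X x)) P := by
  let _ := weakBaire X
  exact Integrable.of_bound
    (measurable_weakBaire_of_continuous k.toContinuousMap).aestronglyMeasurable ‖k‖
    (Eventually.of_forall fun x => k.norm_coe_le_norm _)

/-- A zero set of positive measure of a weakly continuous function meets the support of a
`τ`-smooth measure. Without `τ`-smoothness the support may be empty. -/
theorem exists_mem_weakSupport_of_isTauSmooth {P : @Measure X (weakBaire X)}
    [@IsFiniteMeasure X (weakBaire X) P] (hP : IsTauSmooth X P)
    (u : C(WeakSpace ℝ X, ℝ)) (hu : ∀ x, 0 ≤ u x)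
    (hpos : P {x | u (toWeakSpace ℝ X x) = 0} ≠ 0) :
    ∃ x ∈ weakSupport P, u (toWeakSpace ℝ X x) = 0 := by
  let _ := weakBaire X
  by_contra! hcon
  have hmeas : MeasurableSet {x : X | u (toWeakSpace ℝ X x) = 0} :=
    measurable_weakBaire_of_continuous u (measurableSet_singleton 0)
  -- The functions `max (1 - w) 0` decrease to `0` along the directed set `W`, as no zero of `u`
  -- lies in the support, while each of their integrals is at least `P {u = 0}`.
  let W := {w : C(WeakSpace ℝ X, ℝ) // (∀ z, 0 ≤ w z) ∧
    ∀ᵐ x ∂P, u (toWeakSpace ℝ X x) = 0 → w (toWeakSpace ℝ X x) = 0}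
  have : Nonempty W := ⟨⟨u, hu, Eventually.of_forall fun _ => id⟩⟩
  have : IsDirectedOrder W := ⟨fun a b => ⟨⟨a.1 + b.1, fun z => add_nonneg (a.2.1 z) (b.2.1 z), by
      filter_upwards [a.2.2, b.2.2] with x ha hb hx
      simp [ha hx, hb hx]⟩,
    fun z => le_add_of_nonneg_right (b.2.1 z), fun z => le_add_of_nonneg_left (a.2.1 z)⟩⟩
  let g (w : W) : BoundedContinuousFunction (WeakSpace ℝ X) ℝ :=
    BoundedContinuousFunction.ofNormedAddCommGroup (fun z => max (1 - w.1 z) 0)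
      ((continuous_const.sub w.1.continuous).max continuous_const) 1 (fun z => by
        rw [Real.norm_of_nonneg (le_max_right _ _)]
        exact max_le (sub_le_self _ (w.2.1 z)) zero_le_one)
  have hg (w : W) (z : WeakSpace ℝ X) : g w z = max (1 - w.1 z) 0 := rfl
  have hanti (v w : W) (hvw : v ≤ w) (z : WeakSpace ℝ X) : g w z ≤ g v z :=
    max_le_max (sub_le_sub_left (hvw z) 1) le_rfl
  have hpoint (z : WeakSpace ℝ X) : ∃ w : W, 0 < w.1 z := by
    by_cases hz : u z = 0
    · have hzs : (toWeakSpace ℝ X).symm z ∉ weakSupport P := fun h =>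
        hcon _ h (by simpa using hz)
      simp only [weakSupport, Set.mem_ofPred_eq, not_forall, LinearEquiv.apply_symm_apply] at hzs
      obtain ⟨k, hk0, hk, hkz⟩ := hzs
      have hae : ∀ᵐ x ∂P, k (toWeakSpace ℝ X x) = 0 :=
        (integral_eq_zero_iff_of_nonneg (fun x => hk0 _) (integrable_weakBaire k)).1 hk
      exact ⟨⟨k.toContinuousMap, hk0, hae.mono fun x hx _ => hx⟩,
        lt_of_le_of_ne (hk0 z) (Ne.symm hkz)⟩
    · exact ⟨⟨u, hu, Eventually.of_forall fun _ => id⟩, lt_of_le_of_ne (hu z) (Ne.symm hz)⟩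
  have hlim (z : WeakSpace ℝ X) : Tendsto (fun w => g w z) atTop (𝓝 0) := by
    obtain ⟨w, hw⟩ := hpoint z
    let v : W := ⟨(w.1 z)⁻¹ • w.1, fun z' => mul_nonneg (inv_nonneg.2 hw.le) (w.2.1 z'), by
      filter_upwards [w.2.2] with x h hx
      simp [h hx]⟩
    have hv : g v z = 0 := by
      have h1 : v.1 z = (w.1 z)⁻¹ * w.1 z := rfl
      rw [hg, h1, inv_mul_cancel₀ hw.ne', sub_self, max_self]
    refine tendsto_const_nhds.congr' ?_
    filter_upwards [eventually_ge_atTop v] with w' hw'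
    exact le_antisymm (le_max_right _ _) ((hanti v w' hw' z).trans_eq hv)
  have hge (w : W) : P.real {x | u (toWeakSpace ℝ X x) = 0} ≤
      ∫ x, g w (toWeakSpace ℝ X x) ∂P := by
    rw [← integral_indicator_one hmeas]
    refine integral_mono_ae ((integrable_const 1).indicator hmeas) (integrable_weakBaire _) ?_
    filter_upwards [w.2.2] with x hx
    rw [hg]
    by_cases hxu : u (toWeakSpace ℝ X x) = 0
    · simp [hx hxu, hxu]
    · rw [Set.indicator_of_notMem (s := {x : X | u (toWeakSpace ℝ X x) = 0}) hxu]
      exact le_max_right _ _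
  exact hpos ((measureReal_eq_zero_iff).1
    (le_antisymm (ge_of_tendsto' (hP W g hanti hlim) hge) measureReal_nonneg))

theorem eq_zero_of_mem_weakSupport {P : @Measure X (weakBaire X)} {φ : StrongDual ℝ X}
    (hφ : ∀ᵐ x ∂P, φ x = 0) {x : X} (hx : x ∈ weakSupport P) : φ x = 0 := by
  have hc : Continuous fun z : WeakSpace ℝ X => φ ((toWeakSpace ℝ X).symm z) :=
    WeakBilin.eval_continuous (topDualPairing ℝ X).flip φ
  let k : BoundedContinuousFunction (WeakSpace ℝ X) ℝ :=
    BoundedContinuousFunction.ofNormedAddCommGroup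
      (fun z => min |φ ((toWeakSpace ℝ X).symm z)| 1) (hc.abs.min continuous_const) 1
      (fun z => by
        rw [Real.norm_of_nonneg (by positivity)]
        exact min_le_right _ _)
  have hk (z : X) : k (toWeakSpace ℝ X z) = min |φ z| 1 := by
    change min |φ ((toWeakSpace ℝ X).symm (toWeakSpace ℝ X z))| 1 = _
    rw [LinearEquiv.symm_apply_apply]
  have h0 := hx k (fun z => by
    change 0 ≤ min |φ ((toWeakSpace ℝ X).symm z)| 1
    positivity) (by
    rw [← integral_zero X ℝ (μ := P)]
    refine integral_congr_ae ?_
    filter_upwards [hφ] with z hz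
    rw [hk, hz]; simp)
  rw [hk] at h0
  by_contra hne
  have : 0 < min |φ x| 1 := lt_min (abs_pos.2 hne) one_pos
  linarith

end Support

/-! ### Norm separability of the support -/

section Separability

variable {X : Type*} [NormedAddCommGroup X] [NormedSpace ℝ X]
  {Ω : Type*} [MeasurableSpace Ω] {ν : Measure Ω} {f : Ω → X} {S : Set X}

/-- Almost everywhere convergence of `b n ∘ f` forces convergence on `S`: by the Banach–Alaoglu
theorem `b` has a weak-* limit along each ultrafilter, and this limit agrees with `b₀` almost
everywhere, hence on `S`. -/
theorem tendsto_apply_of_tendsto_ae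
    (hS : ∀ φ : StrongDual ℝ X, (∀ᵐ ω ∂ν, φ (f ω) = 0) → ∀ x ∈ S, φ x = 0)
    {b : ℕ → StrongDual ℝ X} {b₀ : StrongDual ℝ X} (hb : ∀ n, ‖b n‖ ≤ 1)
    (h : ∀ᵐ ω ∂ν, Tendsto (fun n => b n (f ω)) atTop (𝓝 (b₀ (f ω)))) {x : X} (hx : x ∈ S) :
    Tendsto (fun n => b n x) atTop (𝓝 (b₀ x)) := by
  rw [tendsto_iff_ultrafilter]
  intro U hU
  have hcomp := WeakDual.isCompact_closedBall (𝕜 := ℝ) (E := X) 0 1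
  obtain ⟨c, -, hc⟩ := hcomp.ultrafilter_le_nhds
    (U.map fun n => StrongDual.toWeakDual (b n)) (by
      rw [le_principal_iff]
      exact mem_map.2 (univ_mem' fun n => by
        simpa using hb n))
  have hcz (z : X) : Tendsto (fun n => b n z) U (𝓝 (c z)) :=
    ((WeakDual.eval_continuous z).tendsto c).comp hc
  have hcx : (c.toStrongDual - b₀) x = 0 := by
    refine hS _ ?_ x hx
    filter_upwards [h] with ω hω
    exact sub_eq_zero.2 (tendsto_nhds_unique (hcz (f ω)) (hω.mono_left hU))
  have := sub_eq_zero.1 hcx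
  exact this ▸ hcz x

/-- If the functions `φ ∘ f` are measurable for a countably generated `σ`-algebra, and functionals
with `φ ∘ f = 0` almost everywhere vanish on `S`, then `S` is norm separable. -/
theorem isSeparable_of_countablyGenerated [MeasurableSpace.CountablyGenerated Ω]
    [IsFiniteMeasure ν] (hf : ∀ φ : StrongDual ℝ X, Measurable fun ω => φ (f ω))
    (hS : ∀ φ : StrongDual ℝ X, (∀ᵐ ω ∂ν, φ (f ω) = 0) → ∀ x ∈ S, φ x = 0) :
    TopologicalSpace.IsSeparable S := by
  have : Fact ((1 : ENNReal) ≠ ⊤) := ⟨ENNReal.one_ne_top⟩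
  have hmem (φ : StrongDual ℝ X) : MemLp (fun ω => Real.arctan (φ (f ω))) 1 ν :=
    MemLp.of_bound (Real.measurable_arctan.comp (hf φ)).aestronglyMeasurable (Real.pi / 2)
      (Eventually.of_forall fun ω => by
        rw [Real.norm_eq_abs, abs_le]
        exact ⟨(Real.neg_pi_div_two_lt_arctan _).le, (Real.arctan_lt_pi_div_two _).le⟩)
  -- The `L¹` distance of the bounded functions `arctan (φ ∘ f)` metrizes convergence in measure
  -- without any integrability assumption on `φ ∘ f`.
  let U (φ : StrongDual ℝ X) : Lp ℝ 1 ν := (hmem φ).toLp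
  have hseq {b : ℕ → StrongDual ℝ X} {b₀ : StrongDual ℝ X} (hb : ∀ n, ‖b n‖ ≤ 1)
      (h : Tendsto (fun n => U (b n)) atTop (𝓝 (U b₀))) {x : X} (hx : x ∈ S) :
      ∃ m : ℕ → ℕ, Tendsto (fun n => b (m n) x) atTop (𝓝 (b₀ x)) := by
    obtain ⟨m, -, hm⟩ := (tendstoInMeasure_of_tendsto_Lp h).exists_seq_tendsto_ae
    refine ⟨m, tendsto_apply_of_tendsto_ae hS (fun n => hb _) ?_ hx⟩
    have hall : ∀ᵐ ω ∂ν, ∀ n, U (b (m n)) ω = Real.arctan (b (m n) (f ω)) :=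
      ae_all_iff.2 fun n => (hmem _).coeFn_toLp
    filter_upwards [hm, hall, (hmem b₀).coeFn_toLp] with ω h1 h2 h3
    simp only [h2] at h1
    rw [show U b₀ ω = _ from h3] at h1
    have h4 := ((Real.continuousAt_tan).2 (Real.cos_arctan_pos (b₀ (f ω))).ne').tendsto.comp h1
    simpa [Function.comp_def, Real.tan_arctan] using h4
  have hopen {b₀ : StrongDual ℝ X} {x : X} (hx : x ∈ S) (hpos : 0 < b₀ x) :
      ∃ ε > 0, ∀ b : StrongDual ℝ X, ‖b‖ ≤ 1 → dist (U b) (U b₀) < ε → 0 < b x := by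
    by_contra! hcon
    choose b hb hbd hbx using fun n : ℕ => hcon (1 / ((n : ℝ) + 1)) Nat.one_div_pos_of_nat
    obtain ⟨m, hm⟩ := hseq hb (tendsto_iff_dist_tendsto_zero.2 (squeeze_zero
      (fun _ => dist_nonneg) (fun n => (hbd n).le) tendsto_one_div_add_atTop_nhds_zero_nat)) hx
    exact absurd (le_of_tendsto' hm fun n => hbx _) (not_le.2 hpos)
  -- For each basic open set on which some point of `S` is positive, pick one such point; a
  -- functional that vanishes at all these points vanishes on `S`.
  let B := TopologicalSpace.countableBasis (Lp ℝ 1 ν)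
  let G (V : Set (Lp ℝ 1 ν)) (x : X) : Prop :=
    x ∈ S ∧ ∀ b : StrongDual ℝ X, ‖b‖ ≤ 1 → U b ∈ V → 0 < b x
  classical
  let z (V : Set (Lp ℝ 1 ν)) : X := if h : ∃ x, G V x then h.choose else 0
  let E : Set X := z '' B
  have hE : E.Countable := (TopologicalSpace.countable_countableBasis _).image _
  have hsep : TopologicalSpace.IsSeparable
      ((Submodule.span ℝ E).topologicalClosure : Set X) := by
    rw [Submodule.topologicalClosure_coe]
    exact hE.isSeparable.span.closure
  refine hsep.mono fun x hx => ?_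
  by_contra hnot
  obtain ⟨φ, a, hφx, hφ⟩ := geometric_hahn_banach_point_closed
    (Submodule.span ℝ E).topologicalClosure.convex
    (Submodule.span ℝ E).isClosed_topologicalClosure hnot
  have ha : a < 0 := by simpa using hφ 0 (zero_mem _)
  have hφE (e : X) (he : e ∈ E) : φ e = 0 := by
    by_contra hne
    have h := hφ ((a / φ e) • e) (Submodule.smul_mem _ _
      ((Submodule.span ℝ E).le_topologicalClosure (Submodule.subset_span he)))
    rw [map_smul, smul_eq_mul, div_mul_cancel₀ _ hne] at h
    exact lt_irrefl _ h
  have hφ0 : 0 < ‖φ‖ := norm_pos_iff.2 (by rintro rfl; simp at hφx; linarith)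
  let ψ : StrongDual ℝ X := (-‖φ‖⁻¹) • φ
  have hψ : ‖ψ‖ ≤ 1 := by
    rw [norm_smul, norm_neg, norm_inv, norm_norm, inv_mul_cancel₀ hφ0.ne']
  have hψx : 0 < ψ x := by
    change 0 < -‖φ‖⁻¹ * φ x
    exact mul_pos_of_neg_of_neg (neg_lt_zero.2 (inv_pos.2 hφ0)) (hφx.trans ha)
  obtain ⟨ε, hε, hball⟩ := hopen hx hψx
  obtain ⟨V, hVB, hψV, hV⟩ := (TopologicalSpace.isBasis_countableBasis (Lp ℝ 1 ν)).mem_nhds_iff.1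
    (Metric.ball_mem_nhds (U ψ) hε)
  have hex : ∃ x, G V x := ⟨x, hx, fun b hb hbV => hball b hb (hV hbV)⟩
  have hz : G V (z V) := by
    simp only [z, dif_pos hex]
    exact hex.choose_spec
  have h1 := hz.2 ψ hψ hψV
  have h2 : ψ (z V) = -‖φ‖⁻¹ * φ (z V) := rfl
  rw [h2, hφE _ ⟨V, hVB, rfl⟩, mul_zero] at h1
  exact lt_irrefl _ h1

end Separability

/-! ### Lifting strong measurability along `T` -/

/-- Property (D) for the total set of the functionals `y ∘ T`. -/
theorem measurable_weakBaire_of_stronglyMeasurable_comp {X : Type*} [NormedAddCommGroup X]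
    [NormedSpace ℝ X] {Y : Type*} [NormedAddCommGroup Y] [NormedSpace ℝ Y] (hD : HasPropertyD X)
    {T : X →L[ℝ] Y} (hT : Function.Injective T) {Ω : Type*} [MeasurableSpace Ω] {f : Ω → X}
    (hf : StronglyMeasurable fun ω => T (f ω)) : Measurable[_, weakBaire X] f := by
  have htot : IsTotalSet (Set.range fun y : StrongDual ℝ Y => y.comp T) := by
    intro x hx
    have hTx : T x ≠ 0 := fun h => hx (hT (by rw [h, map_zero]))
    obtain ⟨y, hy⟩ := SeparatingDual.exists_ne_zero (R := ℝ) hTx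
    exact ⟨_, ⟨y, rfl⟩, hy⟩
  rw [hD _ htot, measurable_iff_comap_le]
  simp only [functionalSigma, MeasurableSpace.comap_iSup, iSup_le_iff]
  rintro _ ⟨y, rfl⟩
  rw [MeasurableSpace.comap_comp, ← measurable_iff_comap_le, ← BorelSpace.measurable_eq (α := ℝ)]
  exact (y.continuous.comp_stronglyMeasurable hf).measurable

/-- The case of the theorem in which the `σ`-algebra of `Ω` is countably generated and `T ∘ f` is
strongly measurable without an exceptional null set. -/
theorem aestronglyMeasurable_of_stronglyMeasurable_comp {X : Type*} [NormedAddCommGroup X]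
    [NormedSpace ℝ X] [CompleteSpace X] {Y : Type*} [NormedAddCommGroup Y] [NormedSpace ℝ Y]
    {Ω : Type*} [MeasurableSpace Ω] [MeasurableSpace.CountablyGenerated Ω] {ν : Measure Ω}
    [IsProbabilityMeasure ν] (hmc : IsWeaklyMeasureCompact X) (hD : HasPropertyD X)
    {T : X →L[ℝ] Y} (hT : Function.Injective T) {f : Ω → X}
    (hf : StronglyMeasurable fun ω => T (f ω)) : AEStronglyMeasurable f ν := by
  have hfm := measurable_weakBaire_of_stronglyMeasurable_comp hD hT hf
  let P : @Measure X (weakBaire X) := @Measure.map Ω X _ (weakBaire X) f ν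
  have hPprob : @IsProbabilityMeasure X (weakBaire X) P :=
    @Measure.isProbabilityMeasure_map Ω X _ (weakBaire X) ν _ f
      (@Measurable.aemeasurable Ω X _ (weakBaire X) f ν hfm)
  have hτ : IsTauSmooth X P := hmc P hPprob
  have hweak (φ : StrongDual ℝ X) : Measurable[weakBaire X] φ :=
    measurable_weakBaire_of_continuous
      ⟨fun z => φ ((toWeakSpace ℝ X).symm z),
        WeakBilin.eval_continuous (topDualPairing ℝ X).flip φ⟩
  have hsep : TopologicalSpace.IsSeparable (weakSupport P) := by
    refine isSeparable_of_countablyGenerated (ν := ν) (f := f)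
      (fun φ => @Measurable.comp Ω X ℝ _ (weakBaire X) _ _ _ (hweak φ) hfm) fun φ hφ x hx => ?_
    refine eq_zero_of_mem_weakSupport ?_ hx
    have hm : MeasurableSet[weakBaire X] {x | φ x = 0} := hweak φ (measurableSet_singleton 0)
    exact (@ae_map_iff Ω X _ (weakBaire X) ν f
      (@Measurable.aemeasurable Ω X _ (weakBaire X) f ν hfm) _ hm).2 hφ
  let Z : Set X := closure (weakSupport P)
  have hZ : TopologicalSpace.IsSeparable Z := hsep.closure
  -- Countably many functionals separate the points of a separable subspace of `Y` which contains
  -- the images of both `f` and `Z`.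
  obtain ⟨y, hy⟩ := exists_seq_dual_separating
    (TopologicalSpace.IsSeparable.span (R := ℝ)
      (hf.isSeparable_range.union (hZ.image T.continuous)))
  let Φ (x : X) (n : ℕ) : ℝ := y n (T x)
  have hinj {x x' : X} (hx : T x ∈ (Set.range fun ω => T (f ω)) ∪ T '' Z)
      (hx' : T x' ∈ (Set.range fun ω => T (f ω)) ∪ T '' Z) (h : Φ x = Φ x') : x = x' := by
    refine hT (sub_eq_zero.1 (hy _ (Submodule.sub_mem _ (Submodule.subset_span hx)
      (Submodule.subset_span hx')) fun n => ?_))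
    rw [map_sub]
    exact sub_eq_zero.2 (congrFun h n)
  have hΦc : Continuous Φ := continuous_pi fun n => (y n).continuous.comp T.continuous
  have hΦw : Continuous fun z : WeakSpace ℝ X => Φ ((toWeakSpace ℝ X).symm z) :=
    continuous_pi fun n => WeakBilin.eval_continuous (topDualPairing ℝ X).flip ((y n).comp T)
  have hΦf : Measurable fun ω => Φ (f ω) := measurable_pi_lambda _ fun n =>
    ((y n).continuous.comp_stronglyMeasurable hf).measurable
  let _ : MeasurableSpace Z := borel Z
  have : BorelSpace Z := ⟨rfl⟩
  have : TopologicalSpace.SeparableSpace Z := hZ.separableSpace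
  have : SecondCountableTopology Z := UniformSpace.secondCountable_of_separable Z
  have : CompleteSpace Z := isClosed_closure.completeSpace_coe
  have hemb : MeasurableEmbedding fun z : Z => Φ z :=
    Continuous.measurableEmbedding (hΦc.comp continuous_subtype_val) fun z z' h =>
      Subtype.ext (hinj (Or.inr ⟨z, z.2, rfl⟩) (Or.inr ⟨z', z'.2, rfl⟩) h)
  -- Otherwise a closed set of positive measure misses `Φ '' Z`, and its preimage under `Φ`, the
  -- zero set of a weakly continuous function, contains a point of the support.
  have hae : ∀ᵐ ω ∂ν, Φ (f ω) ∈ Set.range fun z : Z => Φ z := by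
    by_contra hnot
    let μ : Measure (ℕ → ℝ) := ν.map fun ω => Φ (f ω)
    have : IsProbabilityMeasure μ := Measure.isProbabilityMeasure_map hΦf.aemeasurable
    have hpos : 0 < μ (Set.range fun z : Z => Φ z)ᶜ := by
      rw [pos_iff_ne_zero, Measure.map_apply hΦf hemb.measurableSet_range.compl]
      exact hnot
    obtain ⟨K, hKsub, hK, hKpos⟩ :=
      hemb.measurableSet_range.compl.exists_lt_isClosed_of_ne_top (measure_ne_top _ _) hpos
    let _ := TopologicalSpace.metrizableSpaceMetric (ℕ → ℝ)
    have hKne : K.Nonempty := nonempty_of_measure_ne_zero hKpos.ne'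
    let u : C(WeakSpace ℝ X, ℝ) :=
      ⟨fun z => Metric.infDist (Φ ((toWeakSpace ℝ X).symm z)) K,
        (Metric.continuous_infDist_pt K).comp hΦw⟩
    have hu (x : X) : u (toWeakSpace ℝ X x) = 0 ↔ Φ x ∈ K := by
      change Metric.infDist (Φ ((toWeakSpace ℝ X).symm (toWeakSpace ℝ X x))) K = 0 ↔ _
      rw [LinearEquiv.symm_apply_apply, ← hK.mem_iff_infDist_zero hKne]
    have hPK : P {x | u (toWeakSpace ℝ X x) = 0} ≠ 0 := by
      have hm : MeasurableSet[weakBaire X] {x | u (toWeakSpace ℝ X x) = 0} :=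
        measurable_weakBaire_of_continuous u (measurableSet_singleton 0)
      rw [@Measure.map_apply Ω X _ (weakBaire X) ν f hfm _ hm]
      rw [Measure.map_apply hΦf hK.measurableSet] at hKpos
      simp only [hu]
      exact hKpos.ne'
    obtain ⟨x, hxS, hx⟩ := exists_mem_weakSupport_of_isTauSmooth hτ u
      (fun _ => Metric.infDist_nonneg) hPK
    exact hKsub ((hu x).1 hx) ⟨⟨x, subset_closure hxS⟩, rfl⟩
  have hfZ : ∀ᵐ ω ∂ν, f ω ∈ Z := by
    filter_upwards [hae] with ω ⟨z, hz⟩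
    exact hinj (Or.inr ⟨z, z.2, rfl⟩) (Or.inl ⟨ω, rfl⟩) hz ▸ z.2
  obtain ⟨ω₀, hω₀⟩ := hfZ.exists
  have hset : MeasurableSet {ω | Φ (f ω) ∈ Set.range fun z : Z => Φ z} :=
    hΦf hemb.measurableSet_range
  -- Inverting the measurable embedding `Φ : Z → ℝ^ℕ` gives a measurable `Z`-valued version of `f`.
  classical
  let h (ω : Ω) : Z := if hω : Φ (f ω) ∈ Set.range fun z : Z => Φ z then hω.choose else ⟨_, hω₀⟩
  have hΦh : (fun z : Z => Φ z) ∘ h =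
      fun ω => if Φ (f ω) ∈ Set.range fun z : Z => Φ z then Φ (f ω) else Φ (f ω₀) := by
    funext ω
    by_cases hω : Φ (f ω) ∈ Set.range fun z : Z => Φ z
    · simp only [Function.comp, h, dif_pos hω, if_pos hω]
      exact hω.choose_spec
    · simp only [Function.comp, h, dif_neg hω, if_neg hω]
  have hh : Measurable h := by
    rw [← hemb.measurable_comp_iff, hΦh]
    exact Measurable.ite hset hΦf measurable_const
  refine ⟨fun ω => h ω, continuous_subtype_val.comp_stronglyMeasurable hh.stronglyMeasurable, ?_⟩
  filter_upwards [hae] with ω hω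
  refine hinj (Or.inl ⟨ω, rfl⟩) (Or.inr ⟨h ω, (h ω).2, rfl⟩) ?_
  have h1 := congrFun hΦh ω
  simp only [Function.comp, if_pos hω] at h1
  exact h1.symm

theorem mainTheorem6
    {X : Type*} [NormedAddCommGroup X] [NormedSpace ℝ X] [CompleteSpace X]
    {Y : Type*} [NormedAddCommGroup Y] [NormedSpace ℝ Y] [CompleteSpace Y]
    {Ω : Type*} [MeasurableSpace Ω] (ν : Measure Ω) [IsProbabilityMeasure ν] [ν.IsComplete]
    (hmc : IsWeaklyMeasureCompact X) (hD : HasPropertyD X)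
    (T : X →L[ℝ] Y) (hT : Function.Injective T)
    (f : Ω → X) (hf : AEStronglyMeasurable (fun ω => T (f ω)) ν) :
    AEStronglyMeasurable f ν := by
  obtain ⟨g, hg, hfg⟩ := hf
  -- Changing `f` to `0` on a measurable null set makes `T ∘ f` strongly measurable everywhere.
  let N : Set Ω := toMeasurable ν {ω | T (f ω) ≠ g ω}
  have hN : ν N = 0 := (measure_toMeasurable _).trans hfg
  have hTf : (fun ω => T (Nᶜ.indicator f ω)) = Nᶜ.indicator g := by
    funext ω
    by_cases hω : ω ∈ N
    · simp [hω]
    · have h1 : T (f ω) = g ω := by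
        by_contra h
        exact hω (subset_toMeasurable ν _ h)
      simp [hω, h1]
  have hsm : StronglyMeasurable fun ω => T (Nᶜ.indicator f ω) :=
    hTf ▸ hg.indicator (measurableSet_toMeasurable _ _).compl
  suffices h : AEStronglyMeasurable (Nᶜ.indicator f) ν by
    refine h.congr ?_
    filter_upwards [measure_eq_zero_iff_ae_notMem.1 hN] with ω hω
    exact Set.indicator_of_mem hω f
  -- The `σ`-algebra generated by `T ∘ f` is countably generated, as the range is separable.
  let R : Set Y := Set.range fun ω => T (Nᶜ.indicator f ω)
  let _ : MeasurableSpace Y := borel Y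
  have : BorelSpace Y := ⟨rfl⟩
  have : TopologicalSpace.SeparableSpace R := hsm.isSeparable_range.separableSpace
  have : SecondCountableTopology R := UniformSpace.secondCountable_of_separable R
  let r (ω : Ω) : R := ⟨_, ω, rfl⟩
  have hr : Measurable r := hsm.measurable.subtype_mk
  -- Passing to this `σ`-algebra loses nothing: strong measurability for it is stronger.
  refine aestronglyMeasurable_of_aestronglyMeasurable_trim hr.comap_le ?_
  have hcg : @MeasurableSpace.CountablyGenerated Ω (MeasurableSpace.comap r inferInstance) :=
    MeasurableSpace.CountablyGenerated.comap r
  have hprob : @IsProbabilityMeasure Ω (MeasurableSpace.comap r inferInstance)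
      (ν.trim hr.comap_le) :=
    @IsProbabilityMeasure.mk Ω (_) _ (by
      rw [trim_measurableSet_eq _ MeasurableSet.univ, measure_univ])
  refine @aestronglyMeasurable_of_stronglyMeasurable_comp X _ _ _ Y _ _ Ω (_) hcg _ hprob hmc hD
    T hT _ ?_
  exact continuous_subtype_val.comp_stronglyMeasurable
    (Measurable.stronglyMeasurable (comap_measurable r))
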